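/- Let $\mathbb T\subset\mathbb R$ be a time scale, i.e. a closed set with $0\in\mathbb T$. Let $\sigma(t)=\inf\{s\in\mathbb T: s>t\}$, let $\mu(t)=\sigma(t)-t$, and let $\mathbb S=\{t\in\mathbb T:\sigma(t)>t\}$ be the set of right-scattered points, for which we assume $\sup\mathbb S=+\infty$. Put $\mathbb T_a^+=\mathbb T\cap[a,\infty)$. Let $n\ge 1$ and let $A$ be a constant complex $n\times n$ matrix (in particular, $A$ may be real). Suppose that $A$ is *strongly stable with respect to $\mathbb T$*, i.e. each eigenvalue $\lambda$ of $A$ satisfies $$\limsup_{\mathbb S\ni t\to+\infty}\frac{1}{\mu(t)}\bigl(|1+\mu(t)\lambda|^2-1\bigr)<0 .$$ Then the central upper exponent $\chi(A)$ of the system $x^\Delta=Ax$ is negative. Here $\chi(A)$ is defined as follows. The $\Delta$-derivative of $f$ at $t\in\mathbb T$ is $f^\Delta(t)=\gamma$ if for each $\varepsilon>0$ there is a neighbourhood $W$ of $t$ with $|f(\sigma(t))-f(s)-\gamma(\sigma(t)-s)|\le\varepsilon|\sigma(t)-s|$ for all $s\in W\cap\mathbb T$. The $\Delta$-integral is $\int_a^b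 f\,\Delta\tau=F(b)-F(a)$, where $F^\Delta=f$. The fundamental matrix $\Phi_A(t,s)$, for $t\ge s$ in $\mathbb T$, is the solution on $\mathbb T_s^+$ of $\Phi_A^\Delta(t,s)=A\,\Phi_A(t,s)$, $\Phi_A(s,s)=E_n$. A function $u:\mathbb T_0^+\to\mathbb R$ is *rd-continuous* if it is continuous at the points with $\sigma(t)=t$ and has finite left-sided limits at left-dense points. An rd-continuous function $u$ with $1+\mu u>0$ on $\mathbb T_0^+$ is called an *upper function* if there is a $C>0$ such that $$|\Phi_A(t,s)|\le C\,e_u(t,s)\quad\text{for all } t\ge s \text{ in } \mathbb T_0^+,\qquad e_u(t,s)=\exp\int_s^t\xi_{\mu(\tau)}(u(\tau))\,\Delta\tau,$$ where $\xi_h(z)=\log(1+zh)/h$ for $h\ne0$ and $\xi_0(z)=z$. Finally, with $U$ the set of all upper functions, $$\chi(A)=\inf_{u\in U}\ \limsup_{\mathbb T\ni t\to\infty}\frac1t\int_0^t u(\tau)\,\Delta\tau ,$$ as an extended real number (equal to $+\infty$ if $U$ is empty). -/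

import Mathlib

open Filter Topology Set
open scoped Matrix.Norms.L2Operator

noncomputable section

namespace TimeScaleODE

/-- Forward jump operator of a time scale `T`. -/
def sigma (T : Set ℝ) (t : ℝ) : ℝ := sInf {s : ℝ | s ∈ T ∧ t < s}

/-- Graininess function of a time scale `T`. -/
def graininess (T : Set ℝ) (t : ℝ) : ℝ := sigma T t - t

/-- The set of right-scattered points of `T`. -/
def rightScattered (T : Set ℝ) : Set ℝ := {t : ℝ | t ∈ T ∧ t < sigma T t}

/-- `T⁺ₐ = [a, ∞) ∩ T`, which is again a time scale, with the same forward jump operator. -/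
def future (T : Set ℝ) (a : ℝ) : Set ℝ := T ∩ Ici a

/-- `f` is rd-continuous on `T`: continuous at right-dense points, with finite left-sided limits at
left-dense points. (At points that are not left-dense the filter `𝓝[T ∩ Iio t] t` is trivial, so
that the second clause is void there.) Functions on `T` are represented by functions on `ℝ` of
which only the values on `T` matter. -/
def RdContinuous (T : Set ℝ) (f : ℝ → ℝ) : Prop :=
  (∀ t ∈ T, sigma T t = t → ContinuousWithinAt f T t) ∧
    ∀ t ∈ T, ∃ l : ℝ, Tendsto f (𝓝[T ∩ Iio t] t) (𝓝 l)

/-- `f` is Δ-differentiable at `t`, on the time scale `T`, with `f^Δ(t) = γ`. -/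
def HasDeltaDerivAt {E : Type*} [NormedAddCommGroup E] [NormedSpace ℝ E]
    (T : Set ℝ) (f : ℝ → E) (γ : E) (t : ℝ) : Prop :=
  ∀ ε : ℝ, 0 < ε → ∃ W ∈ 𝓝 t, ∀ s ∈ W, s ∈ T →
    ‖(f (sigma T t) - f s) - (sigma T t - s) • γ‖ ≤ ε * |sigma T t - s|

/-- `F` is a Δ-antiderivative of `f` on `T`. -/
def IsDeltaAntideriv (T : Set ℝ) (F f : ℝ → ℝ) : Prop :=
  ∀ t ∈ T, HasDeltaDerivAt T F (f t) t

open Classical in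
/-- The Cauchy Δ-integral `∫ₐᵇ f(τ) Δτ = F(b) - F(a)`, where `F` is a Δ-antiderivative of `f`
(which exists for each rd-continuous `f` and is unique up to a constant); `0` if there is none. -/
def deltaIntegral (T : Set ℝ) (f : ℝ → ℝ) (a b : ℝ) : ℝ :=
  if h : ∃ F : ℝ → ℝ, IsDeltaAntideriv T F f then h.choose b - h.choose a else 0

/-- `1 + μ(t) p(t) > 0` on `T`. -/
def PositivelyRegressive (T : Set ℝ) (p : ℝ → ℝ) : Prop :=
  ∀ t ∈ T, 0 < 1 + graininess T t * p t

/-- The cylinder transformation `ξ_h(z)`, for real `z` with `1 + z h > 0`. -/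
def cylinder (h z : ℝ) : ℝ := if h = 0 then z else Real.log (1 + z * h) / h

/-- The generalized exponential function `e_p(t, s)` of a positively regressive `p`. -/
def genExp (T : Set ℝ) (p : ℝ → ℝ) (t s : ℝ) : ℝ :=
  Real.exp (deltaIntegral T (fun τ => cylinder (graininess T τ) (p τ)) s t)

/-- `Φ t s` (for `s ≤ t` in `T`) is the fundamental matrix of `x^Δ = A(t) x`: for each `s ∈ T`,
`Φ(s, s) = E` and `Φ^Δ(t, s) = A(t) Φ(t, s)` on the time scale `T⁺ₛ`. -/
def IsFundamentalMatrix {n : ℕ} (T : Set ℝ) (A : ℝ → Matrix (Fin n) (Fin n) ℂ)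
    (Φ : ℝ → ℝ → Matrix (Fin n) (Fin n) ℂ) : Prop :=
  ∀ s ∈ T, Φ s s = 1 ∧
    ∀ t ∈ future T s, HasDeltaDerivAt (future T s) (fun r => Φ r s) (A t * Φ t s) t

/-- `u` is an upper function of the system `x^Δ = A(t) x`: it is rd-continuous on `T⁺₀` and the
fundamental matrix satisfies `|Φ(t, s)| ≤ C e_u(t, s)` for all `t ≥ s` in `T⁺₀`, with some `C > 0`.
Positive regressivity is no restriction among the regressive `u`, for which `e_u` is
defined: at a right-scattered `s` the inequality with `t = σ(s)` yields
`1 + μ(s) u(s) = e_u(σ(s), s) ≥ 0`. The matrix norm is the operator norm of the Euclidean norm;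
another norm only changes `C`. -/
def IsUpperFunction {n : ℕ} (T : Set ℝ) (A : ℝ → Matrix (Fin n) (Fin n) ℂ) (u : ℝ → ℝ) : Prop :=
  RdContinuous (future T 0) u ∧ PositivelyRegressive (future T 0) u ∧
    ∃ Φ : ℝ → ℝ → Matrix (Fin n) (Fin n) ℂ, IsFundamentalMatrix T A Φ ∧
      ∃ C : ℝ, 0 < C ∧ ∀ s ∈ future T 0, ∀ t ∈ future T 0, s ≤ t →
        ‖Φ t s‖ ≤ C * genExp (future T 0) u t s

/-- `χ_u = limsup_{t → ∞} (1/t) ∫₀ᵗ u(τ) Δτ`, the limit being taken along `t ∈ T`. -/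
def upperMean (T : Set ℝ) (u : ℝ → ℝ) : EReal :=
  limsup (fun t : ℝ => ((1 / t * deltaIntegral (future T 0) u 0 t : ℝ) : EReal)) (atTop ⊓ 𝓟 T)

/-- The central upper exponent of `x^Δ = A(t) x`: the infimum of `χ_u` over all upper functions. -/
def centralUpperExponent {n : ℕ} (T : Set ℝ) (A : ℝ → Matrix (Fin n) (Fin n) ℂ) : EReal :=
  ⨅ u ∈ {u : ℝ → ℝ | IsUpperFunction T A u}, upperMean T u

/-- `A` is strongly stable with respect to `T`: each eigenvalue `l` satisfies
`limsup (|1 + μ(t) l|² - 1) / μ(t) < 0` as `t → ∞` along the right-scattered points. -/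
def StronglyStable {n : ℕ} (T : Set ℝ) (A : Matrix (Fin n) (Fin n) ℂ) : Prop :=
  ∀ l : ℂ, Module.End.HasEigenvalue (Matrix.toLin' A) l →
    limsup (fun t : ℝ =>
      ((1 / graininess T t * (‖1 + (graininess T t : ℂ) * l‖ ^ 2 - 1) : ℝ) : EReal))
      (atTop ⊓ 𝓟 (rightScattered T)) < 0

end TimeScaleODE

end

/-! A constant function `-δ` with small `δ > 0` is an upper function, and its mean is `-δ`.

Strong stability gives `c > 0` with `|1 + μ l| ≤ 1 - c μ` for all eigenvalues `l` at late
right-scattered points (`StronglyStable.exists_norm_le`). The core is to find one norm, independent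
of `μ`, that contracts under every such `1 + μ A`. Let `l₁, …, lₙ` be the roots of the
characteristic polynomial and let `V` be the sum over `j < n` of `ε⁻ʲ ‖(A - l₁) ⋯ (A - lⱼ) X‖`. On
each summand `1 + h A` acts as `1 + h lⱼ₊₁` plus `h` times the next Newton product, and the last
product vanishes by Cayley-Hamilton. Hence `1 + h A` has `V`-norm at most `ρ + h ε` when all `|1 + h
l| ≤ ρ` (`adaptedNorm_step_le`). With `ε = c / 2` the late jumps contract by `1 - (c / 2) μ`.

Right-dense points carry no eigenvalue hypothesis. One late jump of size `μ` suffices for them: `1 +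
h A` with `h ≤ μ` is a convex combination of `1` and `1 + μ A`, so it contracts as well. What
happens before some `t₀` costs only a constant factor. Induction on the time scale
(`seminorm_le_exp`) turns these one-step bounds into `‖Φ(t, s)‖ ≤ C e_{-δ}(t, s)`. -/

noncomputable section

namespace TimeScaleODE

/-! ### Jump operator and induction on time scales -/

section TimeScale

variable {T : Set ℝ} {s t : ℝ}

lemma exists_mem_gt (hub : ¬ BddAbove T) (t : ℝ) : {r : ℝ | r ∈ T ∧ t < r}.Nonempty := by
  obtain ⟨r, hr, htr⟩ := not_bddAbove_iff.1 hub t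
  exact ⟨r, hr, htr⟩

lemma bddBelow_mem_gt (T : Set ℝ) (t : ℝ) : BddBelow {r : ℝ | r ∈ T ∧ t < r} :=
  ⟨t, fun _ hr => hr.2.le⟩

lemma le_sigma (hub : ¬ BddAbove T) (t : ℝ) : t ≤ sigma T t :=
  le_csInf (exists_mem_gt hub t) fun _ hr => hr.2.le

lemma sigma_le {r : ℝ} (hr : r ∈ T) (htr : t < r) : sigma T t ≤ r :=
  csInf_le (bddBelow_mem_gt T t) ⟨hr, htr⟩

lemma sigma_mem (hT : IsClosed T) (hub : ¬ BddAbove T) (t : ℝ) : sigma T t ∈ T :=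
  hT.closure_subset_iff.2 (fun _ hr => hr.1)
    (csInf_mem_closure (exists_mem_gt hub t) (bddBelow_mem_gt T t))

lemma sigma_monotone (hub : ¬ BddAbove T) : Monotone (sigma T) := fun _ b hab =>
  le_csInf (exists_mem_gt hub b) fun _ hr => sigma_le hr.1 (hab.trans_lt hr.2)

lemma graininess_nonneg (hub : ¬ BddAbove T) (t : ℝ) : 0 ≤ graininess T t :=
  sub_nonneg.2 (le_sigma hub t)

lemma sigma_future {a : ℝ} (h : a ≤ t) : sigma (future T a) t = sigma T t := by
  unfold sigma future
  congr 1
  ext r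
  constructor
  · rintro ⟨⟨h1, -⟩, h2⟩
    exact ⟨h1, h2⟩
  · rintro ⟨h1, h2⟩
    exact ⟨⟨h1, h.trans h2.le⟩, h2⟩

lemma graininess_future {a : ℝ} (h : a ≤ t) : graininess (future T a) t = graininess T t := by
  rw [graininess, graininess, sigma_future h]

lemma isClosed_future (hT : IsClosed T) (a : ℝ) : IsClosed (future T a) := hT.inter isClosed_Ici

lemma not_bddAbove_future (hub : ¬ BddAbove T) (a : ℝ) : ¬ BddAbove (future T a) := by
  rw [not_bddAbove_iff] at hub ⊢
  intro x
  obtain ⟨y, hy, hxy⟩ := hub (max x a)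
  exact ⟨y, ⟨hy, (le_max_right x a).trans hxy.le⟩, (le_max_left x a).trans_lt hxy⟩

lemma future_future {a b : ℝ} (h : a ≤ b) : future (future T a) b = future T b := by
  ext r
  exact ⟨fun hr => ⟨hr.1.1, hr.2⟩, fun hr => ⟨⟨hr.1, h.trans hr.2⟩, hr.2⟩⟩

/-- Induction on a time scale. -/
theorem time_scale_induction (hT : IsClosed T) (hub : ¬ BddAbove T) (hs : s ∈ T) (P : ℝ → Prop)
    (start : P s)
    (jump : ∀ t ∈ future T s, t < sigma T t → P t → P (sigma T t))
    (dense : ∀ t ∈ future T s, sigma T t = t → P t → ∀ᶠ r in 𝓝[>] t, r ∈ T → P r)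
    (limit : ∀ t ∈ future T s, (𝓝[T ∩ Iio t] t).NeBot →
      (∀ r ∈ future T s, r < t → P r) → P t)
    (t : ℝ) (ht : t ∈ future T s) : P t := by
  by_contra hPt
  set B := {r : ℝ | r ∈ future T s ∧ ¬ P r} with hB
  have hne : B.Nonempty := ⟨t, ht, hPt⟩
  have hbdd : BddBelow B := ⟨s, fun r hr => hr.1.2⟩
  set m := sInf B with hm
  have hmF : m ∈ future T s :=
    (isClosed_future hT s).closure_subset_iff.2 (fun _ hr => hr.1) (csInf_mem_closure hne hbdd)
  have hlt : ∀ r ∈ future T s, r < m → P r := by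
    intro r hr hrm
    by_contra h
    exact absurd (csInf_le hbdd ⟨hr, h⟩) (not_le.2 hrm)
  have hPm : P m := by
    by_cases hnb : (𝓝[T ∩ Iio m] m).NeBot
    · exact limit m hmF hnb hlt
    · rcases eq_or_lt_of_le (mem_Ici.1 hmF.2) with h | hsm
      · rw [← h]; exact start
      -- Here `m > s` is isolated from the left, so it is the successor of `r` and the jump
      -- hypothesis applies at `r`.
      · set r := sSup (T ∩ Iio m) with hr
        have hne' : (T ∩ Iio m).Nonempty := ⟨s, hs, hsm⟩
        have hbd' : BddAbove (T ∩ Iio m) := ⟨m, fun x hx => hx.2.le⟩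
        have hrcl : r ∈ closure (T ∩ Iio m) := csSup_mem_closure hne' hbd'
        have hrT : r ∈ T := hT.closure_subset_iff.2 (fun _ hx => hx.1) hrcl
        have hrm : r < m := by
          refine lt_of_le_of_ne (csSup_le hne' fun x hx => hx.2.le) fun h => hnb ?_
          rw [← mem_closure_iff_nhdsWithin_neBot, ← h, h]
          rwa [h] at hrcl
        have hrs : s ≤ r := le_csSup hbd' ⟨hs, hsm⟩
        have hσ : sigma T r = m := by
          refine le_antisymm (sigma_le hmF.1 hrm) (not_lt.1 fun h => ?_)
          have h1 : sigma T r ≤ r := le_csSup hbd' ⟨sigma_mem hT hub r, h⟩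
          have h2 : sigma T r ∈ closure {x : ℝ | x ∈ T ∧ r < x} :=
            csInf_mem_closure (exists_mem_gt hub r) (bddBelow_mem_gt T r)
          have h3 : {x : ℝ | x ∈ T ∧ r < x} ⊆ Ici m := by
            intro x hx
            by_contra hxm
            exact absurd (le_csSup hbd' ⟨hx.1, mem_Iio.2 (not_le.1 hxm)⟩) (not_le.2 hx.2)
          exact absurd (closure_minimal h3 isClosed_Ici h2) (not_le.2 h)
        rw [← hσ]
        exact jump r ⟨hrT, hrs⟩ (hσ ▸ hrm) (hlt r ⟨hrT, hrs⟩ hrm)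
  rcases eq_or_lt_of_le (le_sigma hub m) with h | h
  · have hev := dense m hmF h.symm hPm
    obtain ⟨b, hb, hsub⟩ := mem_nhdsGT_iff_exists_Ioo_subset.1 hev
    have : b ≤ m := le_csInf hne fun r hr => by
      by_contra hrb
      have hmr : m < r := lt_of_le_of_ne (csInf_le hbdd hr) fun h => hr.2 (h ▸ hPm)
      exact hr.2 (hsub ⟨hmr, not_le.1 hrb⟩ hr.1.1)
    exact absurd this (not_le.2 hb)
  · have : sigma T m ≤ m := le_csInf hne fun r hr => by
      have hmr : m < r := lt_of_le_of_ne (csInf_le hbdd hr) fun h => hr.2 (h ▸ hPm)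
      exact sigma_le hr.1.1 hmr
    exact absurd this (not_le.2 h)

end TimeScale

/-! ### Calculus of the Δ-derivative -/

section DeltaDeriv

variable {E : Type*} [NormedAddCommGroup E] [NormedSpace ℝ E] {T : Set ℝ} {f g : ℝ → E} {γ : E}
  {t : ℝ}

/-- The point `t` itself lies in each neighbourhood `W`, and there the left side of the definition
does not depend on `ε`. -/
lemma HasDeltaDerivAt.apply_sigma (ht : t ∈ T) (hub : ¬ BddAbove T)
    (h : HasDeltaDerivAt T f γ t) : f (sigma T t) = f t + graininess T t • γ := by
  have key : ‖f (sigma T t) - f t - (sigma T t - t) • γ‖ ≤ 0 := by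
    refine le_of_forall_pos_le_add fun ε hε => ?_
    have hμ := graininess_nonneg hub t
    obtain ⟨W, hW, hs⟩ := h (ε / (graininess T t + 1)) (by positivity)
    refine (hs t (mem_of_mem_nhds hW) ht).trans ?_
    have h1 : |sigma T t - t| = graininess T t := abs_of_nonneg hμ
    rw [h1, zero_add, div_mul_eq_mul_div, div_le_iff₀ (by positivity)]
    nlinarith
  have := norm_le_zero_iff.1 key
  rwa [sub_sub, sub_eq_zero] at this

/-- Recentring from `f (σ t)` to `f t` gives the usual first-order expansion; at a right-dense point
the error is `ε |t - r|`. -/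
lemma HasDeltaDerivAt.eventually_norm_sub_le (ht : t ∈ T) (hub : ¬ BddAbove T)
    (h : HasDeltaDerivAt T f γ t) {ε : ℝ} (hε : 0 < ε) :
    ∀ᶠ r in 𝓝[T] t, ‖f r - f t - (r - t) • γ‖ ≤ ε * |sigma T t - r| := by
  obtain ⟨W, hW, hs⟩ := h ε hε
  filter_upwards [mem_nhdsWithin_of_mem_nhds hW, self_mem_nhdsWithin] with r hrW hrT
  have := hs r hrW hrT
  rw [h.apply_sigma ht hub] at this
  rw [← norm_neg]
  have heq : -(f r - f t - (r - t) • γ) =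
      f t + graininess T t • γ - f r - (sigma T t - r) • γ := by
    unfold graininess
    module
  rwa [heq]

lemma HasDeltaDerivAt.continuousWithinAt (ht : t ∈ T) (hub : ¬ BddAbove T)
    (h : HasDeltaDerivAt T f γ t) : ContinuousWithinAt f T t := by
  have hμ := graininess_nonneg hub t
  rw [ContinuousWithinAt, tendsto_iff_norm_sub_tendsto_zero]
  refine tendsto_order.2 ⟨fun a ha => Eventually.of_forall fun r => ha.trans_le (norm_nonneg _),
    fun a ha => ?_⟩
  have hε : 0 < a / (2 * (graininess T t + 1)) := by positivity
  have hcont : Tendsto (fun r : ℝ => |r - t| * ‖γ‖ +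
      a / (2 * (graininess T t + 1)) * |sigma T t - r|) (𝓝[T] t)
      (𝓝 (|t - t| * ‖γ‖ + a / (2 * (graininess T t + 1)) * |sigma T t - t|)) :=
    Tendsto.mono_left (Continuous.tendsto (by fun_prop) t) nhdsWithin_le_nhds
  have hlt : |t - t| * ‖γ‖ + a / (2 * (graininess T t + 1)) * |sigma T t - t| < a := by
    have h1 : |sigma T t - t| = graininess T t := abs_of_nonneg hμ
    rw [h1, sub_self, abs_zero, zero_mul, zero_add, div_mul_eq_mul_div, div_lt_iff₀ (by positivity)]
    nlinarith
  filter_upwards [h.eventually_norm_sub_le ht hub hε, hcont.eventually_lt_const hlt] with r h1 h2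
  calc ‖f r - f t‖ = ‖(r - t) • γ + (f r - f t - (r - t) • γ)‖ := by congr 1; abel
    _ ≤ |r - t| * ‖γ‖ + a / (2 * (graininess T t + 1)) * |sigma T t - r| := by
      refine (norm_add_le _ _).trans (add_le_add ?_ h1)
      rw [norm_smul, Real.norm_eq_abs]
    _ < a := h2

lemma HasDeltaDerivAt.mono_future {a : ℝ} (hat : a ≤ t) (h : HasDeltaDerivAt T f γ t) :
    HasDeltaDerivAt (future T a) f γ t := by
  intro ε hε
  obtain ⟨W, hW, hs⟩ := h ε hε
  exact ⟨W, hW, fun r hrW hr => by rw [sigma_future hat]; exact hs r hrW hr.1⟩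

lemma HasDeltaDerivAt.congr (hσ : sigma T t ∈ T) (hfg : ∀ r ∈ T, g r = f r)
    (h : HasDeltaDerivAt T f γ t) : HasDeltaDerivAt T g γ t := by
  intro ε hε
  obtain ⟨W, hW, hs⟩ := h ε hε
  exact ⟨W, hW, fun r hrW hr => by rw [hfg r hr, hfg _ hσ]; exact hs r hrW hr⟩

lemma HasDeltaDerivAt.const_add (c : E) (h : HasDeltaDerivAt T f γ t) :
    HasDeltaDerivAt T (fun r => c + f r) γ t := by
  simpa [HasDeltaDerivAt, add_sub_add_left_eq_sub] using h

lemma HasDeltaDerivAt.add_smul_id (c : E) (h : HasDeltaDerivAt T f γ t) :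
    HasDeltaDerivAt T (fun r => f r + r • c) (γ + c) t := by
  intro ε hε
  obtain ⟨W, hW, hs⟩ := h ε hε
  refine ⟨W, hW, fun r hrW hr => ?_⟩
  convert hs r hrW hr using 2
  module

lemma hasDeltaDerivAt_const_mul_id (T : Set ℝ) (c t : ℝ) :
    HasDeltaDerivAt T (fun r => c * r) c t := by
  intro ε hε
  refine ⟨univ, univ_mem, fun r _ _ => ?_⟩
  have : c * sigma T t - c * r - (sigma T t - r) • c = 0 := by rw [smul_eq_mul]; ring
  rw [this, norm_zero]
  positivity

/-- A function with vanishing Δ-derivative is constant. -/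
theorem eq_of_hasDeltaDerivAt_zero {s : ℝ} (hT : IsClosed T) (hub : ¬ BddAbove T) (hs : s ∈ T)
    (h : ∀ t ∈ future T s, HasDeltaDerivAt T f 0 t) (ht : t ∈ future T s) : f t = f s := by
  rw [← sub_eq_zero, ← norm_le_zero_iff]
  refine le_of_forall_pos_le_add fun η hη => ?_
  -- The induction runs on the linear bound `ε (t - s)`, whose slope absorbs the error at each
  -- right-dense point.
  obtain ⟨ε, hε, hεη⟩ : ∃ ε : ℝ, 0 < ε ∧ ε * (t - s) ≤ η := by
    have := sub_nonneg.2 (mem_Ici.1 ht.2)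
    refine ⟨η / (t - s + 1), by positivity, ?_⟩
    rw [div_mul_eq_mul_div, div_le_iff₀ (by positivity)]
    nlinarith
  rw [zero_add]
  refine le_trans ?_ hεη
  refine time_scale_induction hT hub hs (fun t => ‖f t - f s‖ ≤ ε * (t - s)) (s := s) (by simp)
    ?_ ?_ ?_ t ht
  · intro t ht hlt hP
    have := (h t ht).apply_sigma ht.1 hub
    rw [smul_zero, add_zero] at this
    simp only [this]
    exact hP.trans (by gcongr)
  · intro t ht hd hP
    have := (h t ht).eventually_norm_sub_le ht.1 hub hε
    rw [eventually_nhdsWithin_iff] at this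
    filter_upwards [mem_nhdsWithin_of_mem_nhds this, self_mem_nhdsWithin] with r hr hrt hrT
    have h1 := hr hrT
    rw [smul_zero, sub_zero, hd, abs_sub_comm, abs_of_pos (sub_pos.2 hrt)] at h1
    calc ‖f r - f s‖ = ‖(f r - f t) + (f t - f s)‖ := by congr 1; abel
      _ ≤ ε * (r - t) + ε * (t - s) := (norm_add_le _ _).trans (add_le_add h1 hP)
      _ = ε * (r - s) := by ring
  · intro t ht hnb hP
    have hc := ((h t ht).continuousWithinAt ht.1 hub).mono (inter_subset_left (t := Iio t))
    rcases eq_or_lt_of_le (mem_Ici.1 ht.2) with hst | hst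
    · simp [← hst]
    refine le_of_tendsto_of_tendsto (hc.sub_const (f s)).norm
      (Tendsto.mono_left (Continuous.tendsto (f := fun r : ℝ => ε * (r - s)) (by fun_prop) t)
        nhdsWithin_le_nhds) ?_
    filter_upwards [self_mem_nhdsWithin, mem_nhdsWithin_of_mem_nhds (Ioi_mem_nhds hst)] with r h1 h2
    exact hP r ⟨h1.1, mem_Ici.2 (le_of_lt h2)⟩ h1.2

/-- The Cauchy integral of a constant. -/
theorem deltaIntegral_const {s : ℝ} (hT : IsClosed T) (hub : ¬ BddAbove T) (hs : s ∈ T)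
    (ht : t ∈ future T s) (c : ℝ) : deltaIntegral T (fun _ => c) s t = c * (t - s) := by
  have hex : ∃ F : ℝ → ℝ, IsDeltaAntideriv T F fun _ => c :=
    ⟨fun r => c * r, fun t _ => hasDeltaDerivAt_const_mul_id T c t⟩
  rw [deltaIntegral, dif_pos hex]
  have hF := hex.choose_spec
  -- The integral uses an unspecified antiderivative, which therefore has to be compared with `r ↦ c
  -- * r`.
  have h0 : ∀ t ∈ future T s, HasDeltaDerivAt T (fun r => hex.choose r + r • (-c)) 0 t := by
    intro t ht
    simpa using (hF t ht.1).add_smul_id (-c)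
  have := eq_of_hasDeltaDerivAt_zero hT hub hs h0 ht
  simp only [smul_eq_mul] at this
  linarith

end DeltaDeriv

/-! ### Δ-antiderivatives as Lebesgue integrals of step extensions -/

section Floor

variable {T : Set ℝ} {s t : ℝ}

/-- The last point of `T` before `max s x`. -/
def floorPt (T : Set ℝ) (s x : ℝ) : ℝ := sSup (T ∩ Iic (max s x))

lemma bddAbove_inter_Iic (T : Set ℝ) (x : ℝ) : BddAbove (T ∩ Iic x) := ⟨x, fun _ h => h.2⟩

lemma le_floorPt {r x : ℝ} (hr : r ∈ T) (h : r ≤ max s x) : r ≤ floorPt T s x :=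
  le_csSup (bddAbove_inter_Iic T _) ⟨hr, h⟩

lemma self_le_floorPt (hs : s ∈ T) (x : ℝ) : s ≤ floorPt T s x := le_floorPt hs (le_max_left s x)

lemma floorPt_le (hs : s ∈ T) (x : ℝ) : floorPt T s x ≤ max s x :=
  csSup_le ⟨s, hs, mem_Iic.2 (le_max_left s x)⟩ fun _ h => h.2

lemma floorPt_mem (hT : IsClosed T) (hs : s ∈ T) (x : ℝ) : floorPt T s x ∈ T :=
  hT.closure_subset_iff.2 (fun _ h => h.1)
    (csSup_mem_closure ⟨s, hs, mem_Iic.2 (le_max_left s x)⟩ (bddAbove_inter_Iic T _))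

lemma floorPt_mem_future (hT : IsClosed T) (hs : s ∈ T) (x : ℝ) : floorPt T s x ∈ future T s :=
  ⟨floorPt_mem hT hs x, self_le_floorPt hs x⟩

lemma floorPt_monotone (hs : s ∈ T) : Monotone (floorPt T s) := fun _ _ hxy =>
  csSup_le_csSup (bddAbove_inter_Iic T _) ⟨s, hs, mem_Iic.2 (le_max_left s _)⟩
    (inter_subset_inter_right T (Iic_subset_Iic.2 (max_le_max_left s hxy)))

lemma floorPt_eq {y : ℝ} (ht : t ∈ future T s) (hs : s ∈ T) (hty : t ≤ y) (hy : y < sigma T t) :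
    floorPt T s y = t := by
  have hsy : max s y = y := max_eq_right ((mem_Ici.1 ht.2).trans hty)
  refine le_antisymm (csSup_le ⟨s, hs, mem_Iic.2 (le_max_left s y)⟩ fun r hr => ?_)
    (le_floorPt ht.1 (by rwa [hsy]))
  rw [hsy] at hr
  by_contra h
  exact absurd (sigma_le hr.1 (not_le.1 h)) (not_le.2 (lt_of_le_of_lt hr.2 hy))

variable {E : Type*} [NormedAddCommGroup E]

lemma intervalIntegrable_of_bounded {f : ℝ → E}
    (hm : MeasureTheory.StronglyMeasurable f) (a b : ℝ)
    {C : ℝ} (hC : ∀ x ∈ uIoc a b, ‖f x‖ ≤ C) : IntervalIntegrable f MeasureTheory.volume a b := by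
  rw [intervalIntegrable_iff]
  exact MeasureTheory.Measure.integrableOn_of_bounded (by simp) hm.aestronglyMeasurable
    (MeasureTheory.ae_restrict_of_forall_mem measurableSet_uIoc hC)

/-- Precomposition with `max s` makes `f` continuous on the whole line, and the monotone `floorPt`
is measurable. -/
lemma stronglyMeasurable_comp_floorPt {f : ℝ → E} (hs : s ∈ T) (hf : ContinuousOn f (Ici s)) :
    MeasureTheory.StronglyMeasurable fun y => f (floorPt T s y) := by
  have hc : Continuous fun x => f (max s x) :=
    hf.comp_continuous (by fun_prop) fun x => mem_Ici.2 (le_max_left s x)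
  have := hc.comp_stronglyMeasurable (floorPt_monotone hs).measurable.stronglyMeasurable
  simpa only [max_eq_right (self_le_floorPt hs _)] using this

lemma intervalIntegrable_comp_floorPt {f : ℝ → E} (hs : s ∈ T) (hf : ContinuousOn f (Ici s))
    (a b : ℝ) : IntervalIntegrable (fun y => f (floorPt T s y)) MeasureTheory.volume a b := by
  obtain ⟨C, hC⟩ := (isCompact_Icc (a := s) (b := max s (max a b))).exists_bound_of_continuousOn
    (hf.mono Icc_subset_Ici_self)
  refine intervalIntegrable_of_bounded (stronglyMeasurable_comp_floorPt hs hf) a b (C := C)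
    fun x hx => hC _ ⟨self_le_floorPt hs x, (floorPt_le hs x).trans ?_⟩
  have : x ≤ max a b := (uIoc_subset_uIcc hx).2
  exact max_le_max_left s this

variable [NormedSpace ℝ E] [CompleteSpace E]

/-- The integral of the step extension of `f` is a Δ-antiderivative of `f`. -/
theorem hasDeltaDerivAt_integral {f : ℝ → E} (hub : ¬ BddAbove T) (hs : s ∈ T)
    (hint : ∀ a b : ℝ, IntervalIntegrable (fun y => f (floorPt T s y)) MeasureTheory.volume a b)
    (ht : t ∈ future T s) (hf : sigma T t = t → ContinuousWithinAt f (future T s) t)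
    (hT : IsClosed T) :
    HasDeltaDerivAt (future T s) (fun x => ∫ y in s..x, f (floorPt T s y)) (f t) t := by
  intro ε hε
  rw [sigma_future ht.2]
  rcases eq_or_lt_of_le (le_sigma hub t) with hd | hlt
  · have hev : ∀ᶠ r in 𝓝[future T s] t, ‖f r - f t‖ ≤ ε := by
      filter_upwards [(tendsto_iff_norm_sub_tendsto_zero.1 (hf hd.symm)).eventually_lt_const hε]
        with r hr using hr.le
    rw [eventually_nhdsWithin_iff, Metric.eventually_nhds_iff_ball] at hev
    obtain ⟨η, hη, hball⟩ := hev
    refine ⟨Metric.ball t η, Metric.ball_mem_nhds t hη, fun r hr hrT => ?_⟩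
    rw [← hd, intervalIntegral.integral_interval_sub_left (hint _ _) (hint _ _)]
    have hconst : (t - r) • f t = ∫ _ in r..t, f t := by rw [intervalIntegral.integral_const]
    rw [hconst, ← intervalIntegral.integral_sub (hint _ _) (by simp)]
    refine intervalIntegral.norm_integral_le_of_norm_le_const fun y hy => ?_
    have hy' := uIoc_subset_uIcc hy
    have hsy : max s y = y := max_eq_right ((le_min hrT.2 ht.2).trans hy'.1)
    -- Since both ends are in `T`, rounding down keeps `y` between `r` and `t`, inside the ball
    -- where `f` is close to `f t`.
    have hrt : min r t ∈ T := by
      rcases min_choice r t with h | h <;> rw [h]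
      exacts [hrT.1, ht.1]
    have h1 : min r t ≤ floorPt T s y := le_floorPt hrt (by rw [hsy]; exact hy'.1)
    have h2 : floorPt T s y ≤ max r t := (floorPt_le hs y).trans (by rw [hsy]; exact hy'.2)
    exact hball _ ((convex_ball t η).ordConnected.uIcc_subset hr (Metric.mem_ball_self hη) ⟨h1, h2⟩)
      (floorPt_mem_future hT hs y)
  · have hint' : ∫ y in t..sigma T t, f (floorPt T s y) = (sigma T t - t) • f t := by
      rw [← intervalIntegral.integral_const]
      refine intervalIntegral.integral_congr_Ioo_of_le hlt.le fun y hy => ?_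
      simp only [floorPt_eq ht hs hy.1.le hy.2]
    have hc := intervalIntegral.continuous_primitive hint s
    -- At a right-scattered point the error vanishes at `r = t`, while the allowance `ε |σ t - r|`
    -- is positive there; continuity keeps the inequality nearby.
    have hc' : Tendsto (fun r : ℝ => ε * |sigma T t - r| -
        ‖(∫ y in s..sigma T t, f (floorPt T s y)) - (∫ y in s..r, f (floorPt T s y)) -
          (sigma T t - r) • f t‖) (𝓝 t) (𝓝 (ε * |sigma T t - t| -
        ‖(∫ y in s..sigma T t, f (floorPt T s y)) - (∫ y in s..t, f (floorPt T s y)) -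
          (sigma T t - t) • f t‖)) := Continuous.tendsto (by fun_prop) t
    rw [intervalIntegral.integral_interval_sub_left (hint _ _) (hint _ _), hint', sub_self,
      norm_zero, sub_zero] at hc'
    refine ⟨_, hc'.eventually_const_lt (u := 0) ?_, fun r hr _ => ?_⟩
    · have := abs_pos.2 (sub_pos.2 hlt).ne'
      positivity
    · exact (sub_pos.1 hr).le

end Floor

/-! ### Fundamental matrix as a power series -/

section FundamentalMatrix

variable {T : Set ℝ} {s t : ℝ}

/-- The generalized monomials of the time scale `T`, centred at `s`. -/
def monomial (T : Set ℝ) (s : ℝ) : ℕ → ℝ → ℝ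
  | 0, _ => 1
  | k + 1, x => ∫ y in s..x, monomial T s k (floorPt T s y)

lemma continuous_monomial (hs : s ∈ T) (k : ℕ) : Continuous (monomial T s k) := by
  induction k with
  | zero => exact continuous_const
  | succ k ih =>
    exact intervalIntegral.continuous_primitive
      (fun a b => intervalIntegrable_comp_floorPt hs ih.continuousOn a b) s

/-- Rounding down only decreases `y - s`, so the bound from the classical Picard iteration survives.
-/
lemma norm_monomial_le (hs : s ∈ T) (k : ℕ) {x : ℝ} (hx : s ≤ x) :
    ‖monomial T s k x‖ ≤ (x - s) ^ k / k.factorial := by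
  induction k generalizing x with
  | zero => simp [monomial]
  | succ k ih =>
    have hint : ∫ y in s..x, (y - s) ^ k / (k.factorial : ℝ) =
        (x - s) ^ (k + 1) / (k + 1).factorial := by
      rw [intervalIntegral.integral_div, intervalIntegral.integral_comp_sub_right
        (fun z : ℝ => z ^ k) s, integral_pow, Nat.factorial_succ]
      push_cast
      field_simp
      simp
    rw [← hint, monomial]
    refine intervalIntegral.norm_integral_le_of_norm_le hx
      (Eventually.of_forall fun y hy => ?_) (Continuous.intervalIntegrable (by fun_prop) _ _)
    refine (ih (self_le_floorPt hs y)).trans ?_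
    have h1 := self_le_floorPt hs y
    have h2 := floorPt_le hs y
    rw [max_eq_right hy.1.le] at h2
    have h3 := sub_nonneg.2 h1
    gcongr

variable {R : Type*} [NormedRing R] [NormOneClass R] [NormedAlgebra ℂ R] (A : R)

/-- The fundamental solution of `x^Δ = A x`, as a power series in `A`. -/
def fundSol (T : Set ℝ) (t s : ℝ) : R := ∑' k : ℕ, monomial T s k t • A ^ k

lemma norm_monomial_smul_le (hs : s ∈ T) (k : ℕ) {x b : ℝ} (hx : x ∈ Icc s b) :
    ‖monomial T s k x • A ^ k‖ ≤ ((b - s) * ‖A‖) ^ k / k.factorial := by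
  have h0 : 0 ≤ x - s := sub_nonneg.2 hx.1
  have h1 : x - s ≤ b - s := by linarith [hx.2]
  calc ‖monomial T s k x • A ^ k‖ = ‖monomial T s k x‖ * ‖A ^ k‖ := norm_smul _ _
    _ ≤ (b - s) ^ k / k.factorial * ‖A‖ ^ k := by
      have h2 : (x - s) ^ k / (k.factorial : ℝ) ≤ (b - s) ^ k / k.factorial := by gcongr
      exact mul_le_mul ((norm_monomial_le hs k hx.1).trans h2) (norm_pow_le A k) (norm_nonneg _)
        ((div_nonneg (pow_nonneg h0 k) (Nat.cast_nonneg _)).trans h2)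
    _ = ((b - s) * ‖A‖) ^ k / k.factorial := by rw [mul_pow]; ring

variable [CompleteSpace R]

lemma summable_monomial_smul (hs : s ∈ T) {x : ℝ} (hx : s ≤ x) :
    Summable fun k : ℕ => monomial T s k x • A ^ k :=
  .of_norm_bounded (Real.summable_pow_div_factorial _)
    fun k => norm_monomial_smul_le A hs k ⟨hx, le_rfl⟩

lemma continuousOn_fundSol (hs : s ∈ T) : ContinuousOn (fun t => fundSol A T t s) (Ici s) := by
  intro x hx
  have hc : ContinuousOn (fun t => fundSol A T t s) (Icc s (x + 1)) :=
    continuousOn_tsum (fun k => ((continuous_monomial hs k).smul continuous_const).continuousOn)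
      (Real.summable_pow_div_factorial ((x + 1 - s) * ‖A‖))
      fun k y hy => norm_monomial_smul_le A hs k hy
  have hx' := hc x ⟨hx, by linarith⟩
  refine hx'.mono_of_mem_nhdsWithin ?_
  rw [← Ici_inter_Iic]
  exact inter_mem self_mem_nhdsWithin (mem_nhdsWithin_of_mem_nhds (Iic_mem_nhds (by linarith)))

lemma fundSol_self {R : Type*} [NormedRing R] [NormedAlgebra ℂ R] (A : R) (T : Set ℝ) (s : ℝ) :
    fundSol A T s s = 1 := by
  rw [fundSol, tsum_eq_single 0]
  · simp [monomial]
  · intro k hk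
    obtain ⟨k, rfl⟩ := Nat.exists_eq_succ_of_ne_zero hk
    simp [monomial]

/-- Integrating the series term by term, under domination by an exponential series, moves the `k`-th
term to the `k + 1`-st. -/
lemma fundSol_eq_integral (hs : s ∈ T) (hst : s ≤ t) :
    fundSol A T t s = 1 + ∫ y in s..t, A * fundSol A T (floorPt T s y) s := by
  have key : HasSum (fun k : ℕ => ∫ y in s..t, A * (monomial T s k (floorPt T s y) • A ^ k))
      (∫ y in s..t, A * fundSol A T (floorPt T s y) s) := by
    refine intervalIntegral.hasSum_integral_of_dominated_convergence
      (fun k _ => ‖A‖ * (((t - s) * ‖A‖) ^ k / k.factorial)) (fun k => ?_) (fun k => ?_) ?_ ?_ ?_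
    · exact (stronglyMeasurable_comp_floorPt hs (f := fun x => A * (monomial T s k x • A ^ k))
        (continuous_const.mul ((continuous_monomial hs k).smul
          continuous_const)).continuousOn).aestronglyMeasurable
    · refine Eventually.of_forall fun y hy => (norm_mul_le _ _).trans ?_
      gcongr
      refine norm_monomial_smul_le A hs k ⟨self_le_floorPt hs y, (floorPt_le hs y).trans ?_⟩
      rw [uIoc_of_le hst] at hy
      exact max_le hst hy.2
    · exact Eventually.of_forall fun y _ =>
        (Real.summable_pow_div_factorial ((t - s) * ‖A‖)).mul_left _
    · simp
    · exact Eventually.of_forall fun y _ =>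
        (summable_monomial_smul A hs (self_le_floorPt hs y)).hasSum.mul_left A
  have hterm : ∀ k : ℕ, ∫ y in s..t, A * (monomial T s k (floorPt T s y) • A ^ k) =
      monomial T s (k + 1) t • A ^ (k + 1) := by
    intro k
    simp_rw [mul_smul_comm, ← pow_succ']
    rw [intervalIntegral.integral_smul_const, monomial]
  simp_rw [hterm] at key
  rw [← key.tsum_eq, fundSol, (summable_monomial_smul A hs hst).tsum_eq_zero_add]
  simp [monomial]

theorem hasDeltaDerivAt_fundSol (hT : IsClosed T) (hub : ¬ BddAbove T) (hs : s ∈ T)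
    (ht : t ∈ future T s) :
    HasDeltaDerivAt (future T s) (fun r => fundSol A T r s) (A * fundSol A T t s) t := by
  have hc : ContinuousOn (fun r => A * fundSol A T r s) (Ici s) :=
    continuousOn_const.mul (continuousOn_fundSol A hs)
  have h := (hasDeltaDerivAt_integral (f := fun r => A * fundSol A T r s) hub hs
    (intervalIntegrable_comp_floorPt hs hc) ht
    (fun _ => (hc t ht.2).mono inter_subset_right) hT).const_add 1
  refine h.congr ?_ fun r hr => fundSol_eq_integral A hs hr.2
  rw [sigma_future ht.2]
  exact ⟨sigma_mem hT hub t, (mem_Ici.1 ht.2).trans (le_sigma hub t)⟩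

end FundamentalMatrix

/-! ### A norm adapted to the spectrum -/

section AdaptedNorm

open Polynomial

variable {R : Type*} [NormedRing R] [NormedAlgebra ℂ R] (A : R) (ε : ℝ)

/-- A weighted sum of the norms of the Newton products `(A - l₁) ⋯ (A - lⱼ) X`. -/
def adaptedNorm : List ℂ → R → ℝ
  | [], _ => 0
  | l :: L, X => ‖X‖ + ε⁻¹ * adaptedNorm L (A * X - l • X)

variable {ε}

lemma continuous_adaptedNorm (L : List ℂ) : Continuous (adaptedNorm A ε L) := by
  induction L with
  | nil => exact continuous_const
  | cons l L ih =>
    exact continuous_norm.add (continuous_const.mul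
      (ih.comp ((continuous_const.mul continuous_id).sub (continuous_const.smul continuous_id))))

lemma adaptedNorm_nonneg (hε : 0 < ε) (L : List ℂ) (X : R) : 0 ≤ adaptedNorm A ε L X := by
  induction L generalizing X with
  | nil => exact le_rfl
  | cons l L ih =>
    have := ih (A * X - l • X)
    unfold adaptedNorm
    positivity

lemma adaptedNorm_add_le (hε : 0 < ε) (L : List ℂ) (X Y : R) :
    adaptedNorm A ε L (X + Y) ≤ adaptedNorm A ε L X + adaptedNorm A ε L Y := by
  induction L generalizing X Y with
  | nil => simp [adaptedNorm]
  | cons l L ih =>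
    have h1 := ih (A * X - l • X) (A * Y - l • Y)
    have h2 : A * (X + Y) - l • (X + Y) = A * X - l • X + (A * Y - l • Y) := by
      rw [mul_add, smul_add]; abel
    have h3 := mul_le_mul_of_nonneg_left h1 (inv_pos.2 hε).le
    have h4 := norm_add_le X Y
    simp only [adaptedNorm, h2]
    linarith

lemma adaptedNorm_smul (L : List ℂ) (a : ℂ) (X : R) :
    adaptedNorm A ε L (a • X) = ‖a‖ * adaptedNorm A ε L X := by
  induction L generalizing X with
  | nil => simp [adaptedNorm]
  | cons l L ih =>
    have h2 : A * (a • X) - l • (a • X) = a • (A * X - l • X) := by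
      rw [mul_smul_comm, smul_sub, smul_comm]
    simp only [adaptedNorm, h2, ih, norm_smul]
    ring

lemma norm_le_adaptedNorm (hε : 0 < ε) {L : List ℂ} (hL : L ≠ []) (X : R) :
    ‖X‖ ≤ adaptedNorm A ε L X := by
  cases L with
  | nil => exact absurd rfl hL
  | cons l L =>
    have := adaptedNorm_nonneg A hε L (A * X - l • X)
    rw [adaptedNorm, le_add_iff_nonneg_right]
    positivity

lemma exists_adaptedNorm_le (hε : 0 < ε) (L : List ℂ) :
    ∃ K : ℝ, 0 < K ∧ ∀ X, adaptedNorm A ε L X ≤ K * ‖X‖ := by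
  induction L with
  | nil => exact ⟨1, one_pos, fun X => by rw [adaptedNorm]; positivity⟩
  | cons l L ih =>
    obtain ⟨K, hK, h⟩ := ih
    refine ⟨1 + ε⁻¹ * (K * (‖A‖ + ‖l‖)), by positivity, fun X => ?_⟩
    have h1 : ‖A * X - l • X‖ ≤ (‖A‖ + ‖l‖) * ‖X‖ := by
      rw [add_mul]
      exact (norm_sub_le _ _).trans (add_le_add (norm_mul_le _ _) (norm_smul_le _ _))
    calc adaptedNorm A ε (l :: L) X ≤ ‖X‖ + ε⁻¹ * (K * ((‖A‖ + ‖l‖) * ‖X‖)) := by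
          rw [adaptedNorm]
          have := (h (A * X - l • X)).trans (mul_le_mul_of_nonneg_left h1 hK.le)
          gcongr
      _ = _ := by ring

/-- With `Y = (A - l) X`, the image of `X` is `(1 + h l) X + h Y`. The term `-‖X‖` on the right
strengthens the induction: applied to `Y`, it cancels the extra `h ‖Y‖`. The annihilation hypothesis
ends the recursion with `X = 0`. -/
lemma adaptedNorm_step_le_aux (hε : 0 < ε) {ρ h : ℝ} (hh : 0 ≤ h) (L : List ℂ)
    (hL : ∀ l ∈ L, ‖1 + (h : ℂ) * l‖ ≤ ρ) (X : R)
    (hX : aeval A (L.map fun l => (Polynomial.X - C l : ℂ[X])).prod * X = 0) :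
    adaptedNorm A ε L (X + (h : ℂ) • (A * X)) ≤
      ρ * adaptedNorm A ε L X + h * ε * (adaptedNorm A ε L X - ‖X‖) := by
  induction L generalizing X with
  | nil =>
    have : X = 0 := by simpa using hX
    simp [adaptedNorm, this]
  | cons l L ih =>
    set Y := A * X - l • X with hY
    have hXY : aeval A (L.map fun l => (Polynomial.X - C l : ℂ[X])).prod * Y = 0 := by
      have : Y = aeval A (Polynomial.X - C l : ℂ[X]) * X := by
        simp [hY, sub_mul, Algebra.smul_def]
      rw [this, ← mul_assoc, ← map_mul, mul_comm]
      simpa using hX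
    have h1 := ih (fun l hl => hL l (List.mem_cons_of_mem _ hl)) Y hXY
    have h2 : A * (X + (h : ℂ) • (A * X)) - l • (X + (h : ℂ) • (A * X)) =
        Y + (h : ℂ) • (A * Y) := by
      rw [hY]
      simp only [mul_add, mul_sub, mul_smul_comm, smul_add, smul_sub]
      rw [smul_comm l (h : ℂ)]
      abel
    have h3 : X + (h : ℂ) • (A * X) = (1 + (h : ℂ) * l) • X + (h : ℂ) • Y := by
      rw [hY]
      module
    have h4 : ‖X + (h : ℂ) • (A * X)‖ ≤ ρ * ‖X‖ + h * ‖Y‖ := by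
      rw [h3]
      refine (norm_add_le _ _).trans ?_
      rw [norm_smul, norm_smul, Complex.norm_real, Real.norm_of_nonneg hh]
      gcongr
      exact hL l List.mem_cons_self
    have h5 := mul_le_mul_of_nonneg_left h1 (inv_pos.2 hε).le
    simp only [adaptedNorm, h2, ← hY]
    refine (add_le_add h4 h5).trans (le_of_eq ?_)
    field_simp
    ring

lemma adaptedNorm_step_le (hε : 0 < ε) {ρ h : ℝ} (hh : 0 ≤ h) (L : List ℂ)
    (hL : ∀ l ∈ L, ‖1 + (h : ℂ) * l‖ ≤ ρ)
    (hA : aeval A (L.map fun l => (Polynomial.X - C l : ℂ[X])).prod = 0) (X : R) :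
    adaptedNorm A ε L (X + (h : ℂ) • (A * X)) ≤ (ρ + h * ε) * adaptedNorm A ε L X := by
  refine (adaptedNorm_step_le_aux A hε hh L hL X (by rw [hA, zero_mul])).trans ?_
  have : 0 ≤ h * ε * ‖X‖ := by positivity
  linarith

end AdaptedNorm

/-! ### Uniform spectral bound from strong stability -/

section StronglyStable

variable {T : Set ℝ} {n : ℕ} {A : Matrix (Fin n) (Fin n) ℂ}

lemma hasEigenvalue_of_mem_roots {l : ℂ} (hl : l ∈ A.charpoly.roots) :
    Module.End.HasEigenvalue (Matrix.toLin' A) l := by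
  rw [Module.End.hasEigenvalue_iff_isRoot_charpoly, Matrix.charpoly_toLin']
  exact Polynomial.isRoot_of_mem_roots hl

open Polynomial in
lemma aeval_prod_roots_charpoly (A : Matrix (Fin n) (Fin n) ℂ) :
    aeval A (A.charpoly.roots.toList.map fun l => (X - C l : ℂ[X])).prod = 0 := by
  have h := (IsAlgClosed.splits A.charpoly).eq_prod_roots
  rw [(Matrix.charpoly_monic A).leadingCoeff, C_1, one_mul] at h
  rw [← Multiset.prod_coe, ← Multiset.map_coe, Multiset.coe_toList, ← h,
    Matrix.aeval_self_charpoly]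

lemma toList_roots_charpoly_ne_nil (hn : 0 < n) (A : Matrix (Fin n) (Fin n) ℂ) :
    A.charpoly.roots.toList ≠ [] := by
  intro h
  have h1 := (IsAlgClosed.splits A.charpoly).natDegree_eq_card_roots
  rw [Matrix.charpoly_natDegree_eq_dim, Fintype.card_fin, ← Multiset.length_toList, h] at h1
  exact hn.ne' h1

/-- The finitely many negative limsups share a bound `-2c`, and `1 - 2 c μ ≤ (1 - c μ)²` permits the
square root. The sign of `1 - c μ` follows from `0 ≤ 1 - 2 c μ`. -/
lemma StronglyStable.exists_norm_le (hA : StronglyStable T A) :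
    ∃ c : ℝ, 0 < c ∧ ∀ᶠ t in atTop ⊓ 𝓟 (rightScattered T), ∀ l ∈ A.charpoly.roots,
      ‖1 + (graininess T t : ℂ) * l‖ ≤ 1 - c * graininess T t := by
  have key : ∀ S : Finset ℂ, (∀ l ∈ S, Module.End.HasEigenvalue (Matrix.toLin' A) l) →
      ∃ c : ℝ, 0 < c ∧ ∀ᶠ t in atTop ⊓ 𝓟 (rightScattered T), ∀ l ∈ S,
        1 / graininess T t * (‖1 + (graininess T t : ℂ) * l‖ ^ 2 - 1) ≤ -(2 * c) := by
    intro S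
    induction S using Finset.induction_on with
    | empty => exact fun _ => ⟨1, one_pos, by simp⟩
    | insert l S _ ih =>
      intro hS
      obtain ⟨c, hc, h⟩ := ih fun l hl => hS l (Finset.mem_insert_of_mem hl)
      obtain ⟨x, hx, hx0⟩ := EReal.lt_iff_exists_real_btwn.1 (hA l (hS l (Finset.mem_insert_self _ _)))
      have hx0' : x < 0 := by exact_mod_cast hx0
      refine ⟨min c (-x / 2), lt_min hc (by linarith), ?_⟩
      filter_upwards [h, eventually_lt_of_limsup_lt hx] with t ht hxt m hm
      have h1 := min_le_left c (-x / 2)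
      have h2 := min_le_right c (-x / 2)
      rcases Finset.mem_insert.1 hm with rfl | hm
      · have : 1 / graininess T t * (‖1 + (graininess T t : ℂ) * m‖ ^ 2 - 1) < x := by
          exact_mod_cast hxt
        linarith
      · linarith [ht m hm]
  obtain ⟨c, hc, h⟩ := key A.charpoly.roots.toFinset
    fun l hl => hasEigenvalue_of_mem_roots (Multiset.mem_toFinset.1 hl)
  refine ⟨c, hc, ?_⟩
  filter_upwards [h, mem_inf_of_right (mem_principal_self _)] with t ht htS l hl
  have hμ : 0 < graininess T t := sub_pos.2 htS.2
  have h1 := ht l (Multiset.mem_toFinset.2 hl)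
  rw [one_div, inv_mul_le_iff₀ hμ] at h1
  have h2 := sq_nonneg ‖1 + (graininess T t : ℂ) * l‖
  refine (abs_le_of_sq_le_sq' (b := 1 - c * graininess T t) ?_ ?_).2
  · nlinarith [sq_nonneg (c * graininess T t)]
  · nlinarith

end StronglyStable

/-! ### Integrability of the cylinder transform -/

section Exponential

variable {T : Set ℝ} {s t δ : ℝ}

/-- The bounds `1 - 1/x ≤ log x ≤ x - 1` agree to first order at `x = 1`. This makes the integrand
of `e_{-δ}` bounded, and continuous at right-dense points. -/
lemma abs_cylinder_add_le {h : ℝ} (hδ : 0 ≤ δ) (hh : 0 ≤ h) (hb : δ * h ≤ 1 / 2) :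
    |cylinder h (-δ) + δ| ≤ 2 * δ ^ 2 * h := by
  rcases eq_or_lt_of_le hh with rfl | hh
  · simp [cylinder]
  have hδh : 0 ≤ δ * h := by positivity
  have hpos : 0 < 1 + -δ * h := by linarith
  have h1 := Real.log_le_sub_one_of_pos hpos
  have h2 := Real.one_sub_inv_le_log_of_pos hpos
  have h3 : (1 + -δ * h)⁻¹ ≤ 1 + δ * h + 2 * (δ * h) ^ 2 := by
    rw [inv_le_iff_one_le_mul₀ hpos]
    nlinarith [mul_nonneg (sq_nonneg (δ * h)) (sub_nonneg.2 hb)]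
  rw [cylinder, if_neg hh.ne', abs_le]
  constructor
  · have : -(2 * δ ^ 2 * h) - δ ≤ Real.log (1 + -δ * h) / h := by
      rw [le_div_iff₀ hh]
      nlinarith
    linarith
  · have : Real.log (1 + -δ * h) / h ≤ -δ := by
      rw [div_le_iff₀ hh]
      linarith
    have : 0 ≤ 2 * δ ^ 2 * h := by positivity
    linarith

lemma mul_cylinder {h z : ℝ} (hh : 0 < h) : h * cylinder h z = Real.log (1 + z * h) := by
  rw [cylinder, if_neg hh.ne', mul_div_cancel₀ _ hh.ne']

lemma measurable_cylinder (z : ℝ) : Measurable fun h => cylinder h z := by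
  unfold cylinder
  exact Measurable.ite (measurableSet_singleton 0) measurable_const (by fun_prop)

/-- Points of `T` accumulate at `t` from the right, and each of them bounds `σ` at all arguments
before it. -/
lemma continuousAt_graininess (hub : ¬ BddAbove T) (hd : sigma T t = t) :
    ContinuousAt (graininess T) t := by
  have h0 : graininess T t = 0 := sub_eq_zero.2 hd
  rw [ContinuousAt, h0]
  refine tendsto_order.2 ⟨fun a ha => Eventually.of_forall fun r =>
    ha.trans_le (graininess_nonneg hub r), fun a ha => ?_⟩
  have hlt : sInf {r : ℝ | r ∈ T ∧ t < r} < t + a / 2 := by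
    change sigma T t < _
    linarith
  obtain ⟨r, hr, hra⟩ := exists_lt_of_csInf_lt (exists_mem_gt hub t) hlt
  filter_upwards [Iio_mem_nhds hr.2, Ioi_mem_nhds (show t - a / 2 < t by linarith)] with y h1 h2
  have := sigma_le hr.1 h1
  rw [mem_Ioi] at h2
  rw [graininess]
  linarith

/-- Without an antiderivative `deltaIntegral` takes the default value `0`, so existence must precede
any estimate of `e_{-δ}`. -/
theorem exists_deltaAntideriv_cylinder (hT : IsClosed T) (hub : ¬ BddAbove T) (hs : s ∈ T)
    (hδ : 0 ≤ δ) (hb : ∀ t ∈ future T s, δ * graininess T t ≤ 1 / 2) :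
    ∃ F : ℝ → ℝ, IsDeltaAntideriv (future T s) F fun τ => cylinder (graininess T τ) (-δ) := by
  have hmeas : Measurable fun y => cylinder (graininess T (floorPt T s y)) (-δ) :=
    (measurable_cylinder _).comp
      (((sigma_monotone hub).measurable.sub measurable_id).comp (floorPt_monotone hs).measurable)
  have hbound : ∀ τ ∈ future T s, |cylinder (graininess T τ) (-δ)| ≤ 2 * δ := by
    intro τ hτ
    have h1 := abs_le.1 (abs_cylinder_add_le hδ (graininess_nonneg hub τ) (hb τ hτ))
    have h2 := mul_le_mul_of_nonneg_left (hb τ hτ) hδ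
    rw [abs_le]
    constructor <;> nlinarith
  refine ⟨_, fun t ht => hasDeltaDerivAt_integral (f := fun τ => cylinder (graininess T τ) (-δ))
    hub hs (fun a b => intervalIntegrable_of_bounded hmeas.stronglyMeasurable a b
      fun y _ => hbound _ (floorPt_mem_future hT hs y)) ht (fun hd => ?_) hT⟩
  have h0 : graininess T t = 0 := sub_eq_zero.2 hd
  have hc : Tendsto (fun τ => 2 * δ ^ 2 * graininess T τ) (𝓝[future T s] t) (𝓝 0) := by
    have := ((continuousAt_graininess hub hd).tendsto.const_mul (2 * δ ^ 2))
    rw [h0, mul_zero] at this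
    exact this.mono_left nhdsWithin_le_nhds
  have hval : cylinder (graininess T t) (-δ) = -δ := by rw [h0, cylinder, if_pos rfl]
  rw [ContinuousWithinAt, hval, tendsto_iff_norm_sub_tendsto_zero]
  refine squeeze_zero' (Eventually.of_forall fun _ => norm_nonneg _) ?_ hc
  filter_upwards [self_mem_nhdsWithin] with τ hτ
  rw [sub_neg_eq_add, Real.norm_eq_abs]
  exact abs_cylinder_add_le hδ (graininess_nonneg hub τ) (hb τ hτ)

end Exponential

/-! ### Comparison with the generalized exponential -/

section Comparison

variable {R : Type*} [NormedRing R] [NormedSpace ℝ R]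

/-- Comparison of a solution of `x^Δ = A x` with a generalized exponential, for a continuous
seminorm `V` that `1 + h A` contracts for small `h` and for the graininess `h` at late points. -/
theorem seminorm_le_exp {T : Set ℝ} {s t t₀ δ κ a K C h₀ : ℝ} {A : R} {V : R → ℝ} {F : ℝ → ℝ}
    {x : ℝ → R} (hT : IsClosed T) (hub : ¬ BddAbove T) (hs : s ∈ T) (ht₀ : t₀ ∈ T)
    (hV : Continuous V) (hV0 : ∀ X, 0 ≤ V X) (hVadd : ∀ X Y, V (X + Y) ≤ V X + V Y)
    (hC : 0 < C) (hVC : ∀ X, V X ≤ C * ‖X‖)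
    (hδ : 0 ≤ δ) (hδκ : δ < κ) (hb : ∀ t ∈ future T s, δ * graininess T t ≤ 1 / 2)
    (ha : 0 ≤ a) (hearly : ∀ h, 0 ≤ h → ∀ X, V (X + h • (A * X)) ≤ (1 + a * h) * V X)
    (hlate : ∀ t ∈ rightScattered T, t₀ ≤ t →
      ∀ X, V (X + graininess T t • (A * X)) ≤ (1 - κ * graininess T t) * V X)
    (hh₀ : 0 < h₀)
    (hsmall : ∀ h, 0 ≤ h → h ≤ h₀ → ∀ X, V (X + h • (A * X)) ≤ (1 - κ * h) * V X)
    (hF : IsDeltaAntideriv (future T s) F fun τ => cylinder (graininess T τ) (-δ))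
    (hx : ∀ t ∈ future T s, HasDeltaDerivAt (future T s) x (A * x t) t)
    (hK : 0 < K) (hxs : V (x s) ≤ K) (ht : t ∈ future T s) :
    V (x t) ≤ K * Real.exp (F t - F s + (a + 2 * δ) * (min t t₀ - min s t₀)) := by
  have hub' := not_bddAbove_future hub s
  -- The term with `min` grows only up to `t₀` and pays there for steps that need not contract.
  refine time_scale_induction hT hub hs
    (fun t => V (x t) ≤ K * Real.exp (F t - F s + (a + 2 * δ) * (min t t₀ - min s t₀)))
    (by simpa using hxs) ?_ ?_ ?_ t ht
  · intro t ht hlt hP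
    have hx1 := (hx t ht).apply_sigma ht hub'
    have hF1 := (hF t ht).apply_sigma ht hub'
    rw [sigma_future ht.2, graininess_future ht.2] at hx1 hF1
    have hμ : 0 < graininess T t := sub_pos.2 hlt
    have hbt := hb t ht
    have hpos : 0 < 1 + -δ * graininess T t := by linarith
    rw [smul_eq_mul, mul_cylinder hμ] at hF1
    set μ := graininess T t with hμdef
    have hσ : sigma T t = t + μ := by rw [hμdef, graininess]; ring
    have hstep : V (x (sigma T t)) ≤ (1 + -δ * μ) *
        Real.exp ((a + 2 * δ) * (min (sigma T t) t₀ - min t t₀)) * V (x t) := by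
      rw [hx1]
      rcases le_or_gt t₀ t with h | h
      · rw [min_eq_right h, min_eq_right (h.trans hlt.le), sub_self, mul_zero, Real.exp_zero,
          mul_one]
        refine (hlate t ⟨ht.1, hlt⟩ h _).trans ?_
        have := hV0 (x t)
        gcongr
        nlinarith
      -- As `t₀ ∈ T`, a jump from before `t₀` does not pass over it.
      · rw [min_eq_left h.le, min_eq_left (sigma_le ht₀ h), hσ, add_sub_cancel_left]
        refine (hearly μ hμ.le _).trans ?_
        refine mul_le_mul_of_nonneg_right ?_ (hV0 _)
        have h1 : 1 + a * μ ≤ Real.exp (a * μ) := by linarith [Real.add_one_le_exp (a * μ)]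
        have h2 : 1 + 2 * δ * μ ≤ Real.exp (2 * δ * μ) := by
          linarith [Real.add_one_le_exp (2 * δ * μ)]
        -- The product is `1 + δ μ (1 - 2 δ μ)`, and `δ μ ≤ 1/2`. Hence the rate `2 δ` offsets the
        -- decay of `e_{-δ}`.
        have h3 : 1 ≤ (1 + -δ * μ) * (1 + 2 * δ * μ) := by
          have : 0 ≤ δ * μ := by positivity
          nlinarith
        have h4 : 1 ≤ (1 + -δ * μ) * Real.exp (2 * δ * μ) :=
          h3.trans (mul_le_mul_of_nonneg_left h2 hpos.le)
        have h5 : Real.exp ((a + 2 * δ) * μ) = Real.exp (a * μ) * Real.exp (2 * δ * μ) := by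
          rw [← Real.exp_add, ← add_mul]
        rw [h5]
        calc 1 + a * μ ≤ Real.exp (a * μ) * 1 := by rwa [mul_one]
          _ ≤ Real.exp (a * μ) * ((1 + -δ * μ) * Real.exp (2 * δ * μ)) := by gcongr
          _ = _ := by ring
    have hexp : K * Real.exp (F (sigma T t) - F s +
        (a + 2 * δ) * (min (sigma T t) t₀ - min s t₀)) = (1 + -δ * μ) *
        Real.exp ((a + 2 * δ) * (min (sigma T t) t₀ - min t t₀)) *
        (K * Real.exp (F t - F s + (a + 2 * δ) * (min t t₀ - min s t₀))) := by
      rw [hF1]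
      nth_rewrite 2 [← Real.exp_log hpos]
      rw [← Real.exp_add, mul_left_comm, ← Real.exp_add]
      congr 2
      ring
    rw [hexp]
    exact hstep.trans (by gcongr)
  · intro t ht hd hP
    set B := K * Real.exp (F t - F s + (a + 2 * δ) * (min t t₀ - min s t₀)) with hB
    have hBpos : 0 < B := by positivity
    -- The gap between the rates is shared equally by the first-order errors of `x` and `F`, so that
    -- `1 - κ h + e h = 1 - δ h - e h`.
    set e := (κ - δ) / 2 with he
    have hepos : 0 < e := by rw [he]; linarith
    have hκ : 0 < κ := by linarith
    have h0 : graininess T t = 0 := sub_eq_zero.2 hd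
    have hx1 := (hx t ht).eventually_norm_sub_le ht hub' (show 0 < e * B / C by positivity)
    have hF1 := (hF t ht).eventually_norm_sub_le ht hub' hepos
    rw [eventually_nhdsWithin_iff] at hx1 hF1
    filter_upwards [mem_nhdsWithin_of_mem_nhds hx1, mem_nhdsWithin_of_mem_nhds hF1,
      self_mem_nhdsWithin, mem_nhdsWithin_of_mem_nhds (Iio_mem_nhds (show t < t + h₀ by linarith)),
      mem_nhdsWithin_of_mem_nhds (Iio_mem_nhds (show t < t + 1 / κ by
        have : 0 < 1 / κ := by positivity
        linarith))] with r hx2 hF2 hrt hr1 hr2 hrT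
    rw [mem_Ioi] at hrt
    rw [mem_Iio] at hr1 hr2
    have hrF : r ∈ future T s := ⟨hrT, (mem_Ici.1 ht.2).trans hrt.le⟩
    have hx3 := hx2 hrF
    have hF3 := hF2 hrF
    rw [sigma_future ht.2, hd, abs_sub_comm, abs_of_pos (sub_pos.2 hrt)] at hx3 hF3
    rw [h0, cylinder, if_pos rfl, smul_eq_mul, Real.norm_eq_abs, abs_le] at hF3
    obtain ⟨h, rfl⟩ : ∃ h, r = t + h := ⟨r - t, by ring⟩
    rw [add_sub_cancel_left] at hx3 hF3
    have hh : 0 < h := by linarith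
    have hκh : κ * h ≤ 1 := by
      have : h < 1 / κ := by linarith
      rw [lt_div_iff₀ hκ] at this
      linarith
    have hup : V (x (t + h)) ≤ (1 - κ * h + e * h) * B := by
      have hsplit : x (t + h) = (x t + h • (A * x t)) + (x (t + h) - x t - h • (A * x t)) := by abel
      rw [hsplit]
      refine (hVadd _ _).trans ?_
      have h1 := (hsmall h hh.le (by linarith) (x t)).trans
        (mul_le_mul_of_nonneg_left hP (by linarith))
      have h2 := (hVC (x (t + h) - x t - h • (A * x t))).trans
        (mul_le_mul_of_nonneg_left hx3 hC.le)
      have h3 : C * (e * B / C * h) = e * h * B := by field_simp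
      linarith
    have hmin : min t t₀ ≤ min (t + h) t₀ := min_le_min_right _ (by linarith)
    have hlow : B * (1 - δ * h - e * h) ≤ K * Real.exp (F (t + h) - F s +
        (a + 2 * δ) * (min (t + h) t₀ - min s t₀)) := by
      have h1 : B * Real.exp (F (t + h) - F t) ≤ K * Real.exp (F (t + h) - F s +
          (a + 2 * δ) * (min (t + h) t₀ - min s t₀)) := by
        rw [hB, mul_assoc, ← Real.exp_add]
        refine mul_le_mul_of_nonneg_left (Real.exp_le_exp.2 ?_) hK.le
        have := mul_le_mul_of_nonneg_left hmin (show 0 ≤ a + 2 * δ by positivity)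
        linarith
      refine le_trans ?_ h1
      have := Real.add_one_le_exp (F (t + h) - F t)
      gcongr
      linarith [hF3.1]
    refine hup.trans (le_trans (le_of_eq ?_) hlow)
    rw [he]
    ring
  · intro t ht hnb hP
    rcases eq_or_lt_of_le (mem_Ici.1 ht.2) with hst | hst
    · rw [← hst]
      simpa using hxs
    have hle : 𝓝[T ∩ Iio t] t ≤ 𝓝[future T s] t := by
      refine nhdsWithin_le_iff.2 ?_
      filter_upwards [self_mem_nhdsWithin, mem_nhdsWithin_of_mem_nhds (Ioi_mem_nhds hst)]
        with r h1 h2 using ⟨h1.1, mem_Ici.2 (le_of_lt h2)⟩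
    have hcx := ((hx t ht).continuousWithinAt ht hub').mono_left hle
    have hcF := ((hF t ht).continuousWithinAt ht hub').mono_left hle
    have hmin : Tendsto (fun r => (a + 2 * δ) * (min r t₀ - min s t₀)) (𝓝[T ∩ Iio t] t)
        (𝓝 ((a + 2 * δ) * (min t t₀ - min s t₀))) :=
      (Continuous.tendsto (by fun_prop) t).mono_left nhdsWithin_le_nhds
    refine le_of_tendsto_of_tendsto ((hV.tendsto _).comp hcx)
      ((((Real.continuous_exp.tendsto _).comp ((hcF.sub_const (F s)).add hmin))).const_mul K) ?_
    filter_upwards [self_mem_nhdsWithin, mem_nhdsWithin_of_mem_nhds (Ioi_mem_nhds hst)]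
      with r h1 h2
    exact hP r ⟨h1.1, mem_Ici.2 (le_of_lt h2)⟩ h1.2

end Comparison

/-! ### A negative constant upper function -/

section UpperFunction

variable {T : Set ℝ}

lemma rdContinuous_const (T : Set ℝ) (c : ℝ) : RdContinuous T fun _ => c :=
  ⟨fun _ _ _ => continuousWithinAt_const, fun _ _ => ⟨c, tendsto_const_nhds⟩⟩

lemma upperMean_const_le (hT : IsClosed T) (hub : ¬ BddAbove T) (h0 : (0 : ℝ) ∈ T) (c : ℝ) :
    upperMean T (fun _ => c) ≤ c := by
  refine limsup_le_of_le (by isBoundedDefault) ?_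
  rw [eventually_inf_principal]
  filter_upwards [eventually_gt_atTop 0] with t ht htT
  rw [deltaIntegral_const (isClosed_future hT 0) (not_bddAbove_future hub 0) ⟨h0, mem_Ici.2 le_rfl⟩
    ⟨⟨htT, mem_Ici.2 ht.le⟩, mem_Ici.2 ht.le⟩]
  refine le_of_eq ?_
  congr 1
  field_simp
  ring

theorem isFundamentalMatrix_fundSol {n : ℕ} [Nonempty (Fin n)] (hT : IsClosed T)
    (hub : ¬ BddAbove T) (A : Matrix (Fin n) (Fin n) ℂ) :
    IsFundamentalMatrix T (fun _ => A) (fundSol A T) := fun s hs =>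
  ⟨fundSol_self A T s, fun _ ht => hasDeltaDerivAt_fundSol A hT hub hs ht⟩

/-- A strongly stable constant system has a negative constant upper function. -/
theorem StronglyStable.exists_isUpperFunction {n : ℕ} (hn : 0 < n) (hT : IsClosed T)
    (h0 : (0 : ℝ) ∈ T) (hS : ¬ BddAbove (rightScattered T)) {A : Matrix (Fin n) (Fin n) ℂ}
    (hA : StronglyStable T A) : ∃ δ : ℝ, 0 < δ ∧ IsUpperFunction T (fun _ => A) fun _ => -δ := by
  have : Nonempty (Fin n) := ⟨⟨0, hn⟩⟩
  have hub : ¬ BddAbove T := fun h => hS (h.mono fun _ ht => ht.1)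
  obtain ⟨c, hc, hev⟩ := hA.exists_norm_le
  rw [eventually_inf_principal, eventually_atTop] at hev
  obtain ⟨t₁, hev⟩ := hev
  obtain ⟨t₀, ht₀, ht₁⟩ := not_bddAbove_iff.1 hub (max t₁ 0)
  have ht₀0 : 0 < t₀ := (le_max_right _ _).trans_lt ht₁
  have hlate : ∀ t ∈ rightScattered T, t₀ ≤ t → ∀ l ∈ A.charpoly.roots.toList,
      ‖1 + (graininess T t : ℂ) * l‖ ≤ 1 - c * graininess T t := fun t ht htt l hl =>
    hev t (((le_max_left _ _).trans ht₁.le).trans htt) ht l (Multiset.mem_toList.1 hl)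
  have hne := toList_roots_charpoly_ne_nil hn A
  have hgrain : ∀ t ∈ future T 0, graininess T t ≤ t₀ + 1 / c := by
    -- Jumps from before `t₀` end by `t₀`; later ones satisfy `0 ≤ |1 + μ l| ≤ 1 - c μ` for some
    -- eigenvalue `l`.
    intro t ht
    have ht0 : 0 ≤ t := ht.2
    have hc' : 0 < 1 / c := by positivity
    rcases lt_or_ge t t₀ with h | h
    · have := sigma_le ht₀ h
      rw [graininess]
      linarith
    rcases eq_or_lt_of_le (le_sigma hub t) with hd | hlt
    · rw [graininess, ← hd]
      linarith
    · obtain ⟨l, hl⟩ := List.exists_mem_of_ne_nil _ hne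
      have h1 := (norm_nonneg _).trans (hlate t ⟨ht.1, hlt⟩ h l hl)
      have h2 : graininess T t ≤ 1 / c := by
        rw [le_div_iff₀ hc]
        linarith
      linarith
  set m := t₀ + 1 / c with hm
  have hmpos : 0 < m := by positivity
  -- The first entry keeps `δ` strictly below the contraction rate `c / 2`, the second gives `δ μ ≤
  -- 1/2`.
  set δ := min (c / 4) (1 / (2 * m)) with hδdef
  have hδ : 0 < δ := lt_min (by positivity) (by positivity)
  have hδκ : δ < c / 2 := (min_le_left _ _).trans_lt (by linarith)
  have hb : ∀ t ∈ future T 0, δ * graininess T t ≤ 1 / 2 := by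
    intro t ht
    calc δ * graininess T t ≤ 1 / (2 * m) * m := by
          have := graininess_nonneg hub t
          gcongr
          · exact min_le_right _ _
          · exact hgrain t ht
      _ = 1 / 2 := by field_simp
  have hε : 0 < c / 2 := by positivity
  set V := adaptedNorm A (c / 2) A.charpoly.roots.toList with hV
  obtain ⟨C, hC, hVC⟩ := exists_adaptedNorm_le A hε A.charpoly.roots.toList
  have hVadd := adaptedNorm_add_le A hε A.charpoly.roots.toList
  have hV0 := adaptedNorm_nonneg A hε A.charpoly.roots.toList
  have hVnorm := norm_le_adaptedNorm A hε hne
  have hVsmul : ∀ r : ℝ, 0 ≤ r → ∀ X, V (r • X) = r * V X := by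
    intro r hr X
    rw [← Complex.coe_smul, hV, adaptedNorm_smul, Complex.norm_real, Real.norm_of_nonneg hr]
  rw [← hV] at hVC hVadd hV0 hVnorm
  have hstep : ∀ t ∈ rightScattered T, t₀ ≤ t →
      ∀ X, V (X + graininess T t • (A * X)) ≤ (1 - c / 2 * graininess T t) * V X := by
    intro t ht htt X
    have := adaptedNorm_step_le A hε (graininess_nonneg hub t) _ (hlate t ht htt)
      (aeval_prod_roots_charpoly A) X
    rw [Complex.coe_smul] at this
    refine this.trans (le_of_eq ?_)
    rw [hV]
    ring
  obtain ⟨τ, hτ, hτt⟩ := not_bddAbove_iff.1 hS t₀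
  have hτμ : 0 < graininess T τ := sub_pos.2 hτ.2
  have hsmall : ∀ h, 0 ≤ h → h ≤ graininess T τ →
      ∀ X, V (X + h • (A * X)) ≤ (1 - c / 2 * h) * V X := by
    intro h hh hhτ X
    set μ := graininess T τ
    have hθ0 : 0 ≤ h / μ := by positivity
    have hθ1 : 0 ≤ 1 - h / μ := sub_nonneg.2 ((div_le_one hτμ).2 hhτ)
    -- Convexity carries the contraction at the single jump `τ` over to all smaller step sizes.
    have hX : X + h • (A * X) = (1 - h / μ) • X + (h / μ) • (X + μ • (A * X)) := by
      rw [smul_add, smul_smul, div_mul_cancel₀ _ hτμ.ne']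
      module
    rw [hX]
    refine (hVadd _ _).trans ?_
    rw [hVsmul _ hθ1, hVsmul _ hθ0]
    have h1 := mul_le_mul_of_nonneg_left (hstep τ hτ hτt.le X) hθ0
    refine (add_le_add_right h1 _).trans (le_of_eq ?_)
    field_simp
    ring
  have hearly : ∀ h, 0 ≤ h → ∀ X, V (X + h • (A * X)) ≤ (1 + C * ‖A‖ * h) * V X := by
    intro h hh X
    refine (hVadd _ _).trans ?_
    rw [hVsmul h hh]
    have h1 : V (A * X) ≤ C * (‖A‖ * V X) := (hVC _).trans
      (mul_le_mul_of_nonneg_left ((norm_mul_le _ _).trans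
        (mul_le_mul_of_nonneg_left (hVnorm X) (norm_nonneg A))) hC.le)
    have h2 := mul_le_mul_of_nonneg_left h1 hh
    linarith
  have h0' : (0 : ℝ) ∈ future T 0 := ⟨h0, mem_Ici.2 le_rfl⟩
  have hgr : ∀ t ∈ future T 0, graininess (future T 0) t = graininess T t :=
    fun t ht => graininess_future ht.2
  have hF := exists_deltaAntideriv_cylinder (isClosed_future hT 0) (not_bddAbove_future hub 0) h0'
    hδ.le fun t ht => by rw [hgr t ht.1]; exact hb t ht.1
  rw [future_future le_rfl] at hF
  have hK : 0 < V 1 := (norm_pos_iff.2 one_ne_zero).trans_le (hVnorm 1)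
  set M := C * ‖A‖ + 2 * δ with hM
  have hM0 : 0 ≤ M := by positivity
  refine ⟨δ, hδ, rdContinuous_const _ _, fun t ht => ?_, fundSol A T,
    isFundamentalMatrix_fundSol hT hub A, V 1 * Real.exp (M * t₀), by positivity, ?_⟩
  · rw [hgr t ht]
    linarith [hb t ht]
  intro s hs t ht hst
  have hs0 : 0 ≤ s := hs.2
  rw [genExp, deltaIntegral, dif_pos hF]
  have hFs : IsDeltaAntideriv (future T s) hF.choose
      fun τ => cylinder (graininess T τ) (-δ) := by
    intro r hr
    have hr0 : r ∈ future T 0 := ⟨hr.1, hs0.trans hr.2⟩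
    have h1 := (hF.choose_spec r hr0).mono_future hr.2
    simp only [future_future hs0, hgr r hr0] at h1
    exact h1
  have key := seminorm_le_exp hT hub hs.1 ht₀ (continuous_adaptedNorm A _) hV0 hVadd hC hVC hδ.le
    hδκ (fun r hr => hb r ⟨hr.1, hs0.trans hr.2⟩) (by positivity) hearly hstep hτμ hsmall hFs
    (fun r hr => hasDeltaDerivAt_fundSol A hT hub hs.1 hr) hK (by rw [fundSol_self])
    ⟨ht.1, mem_Ici.2 hst⟩
  refine (hVnorm _).trans (key.trans ?_)
  rw [mul_assoc, ← Real.exp_add]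
  refine mul_le_mul_of_nonneg_left (Real.exp_le_exp.2 ?_) hK.le
  -- Since `s ≥ 0`, the early loss is bounded independently of `s`.
  have h1 : min t t₀ - min s t₀ ≤ t₀ := by
    have := min_le_right t t₀
    have := le_min hs0 ht₀0.le
    linarith
  have := mul_le_mul_of_nonneg_left h1 hM0
  linarith

end UpperFunction

end TimeScaleODE

end

theorem corollary7p7 {n : ℕ} (hn : 0 < n) (T : Set ℝ) (hclosed : IsClosed T) (hzero : (0 : ℝ) ∈ T)
    (hscattered : ¬ BddAbove (TimeScaleODE.rightScattered T))
    (A : Matrix (Fin n) (Fin n) ℂ) (hA : TimeScaleODE.StronglyStable T A) :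
    TimeScaleODE.centralUpperExponent T (fun _ => A) < 0 := by
  have hub : ¬ BddAbove T := fun h => hscattered (h.mono fun _ ht => ht.1)
  obtain ⟨δ, hδ, hu⟩ := hA.exists_isUpperFunction hn hclosed hzero hscattered
  refine (iInf₂_le _ hu).trans_lt
    ((TimeScaleODE.upperMean_const_le hclosed hub hzero (-δ)).trans_lt ?_)
  exact_mod_cast neg_lt_zero.2 hδ
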